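/- Let $X$ be a Polish space and let $B \subseteq X$ be a nonempty Borel set such that every point of $B$ is a condensation point of $B$, i.e. for every $x \in B$ and every neighbourhood $U$ of $x$ in $X$, the set $U \cap B$ is uncountable. Then there is a continuous bijection from the Baire space $\omega^\omega$ (with the product topology of the discrete spaces $\omega$) onto $B$ (with the subspace topology). -/

import Mathlib

open scoped Topology

/-- A point `x` of a topological space is a condensation point of a set `B` if every
neighbourhood of `x` contains uncountably many points of `B`. -/
def IsCondensationPoint {X : Type*} [TopologicalSpace X] (x : X) (B : Set X) : Prop :=
  ∀ U ∈ 𝓝 x, ¬ (U ∩ B).Countable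

/-!
Call a set an *injective Baire image* if it is the range of a continuous injection of the Baire
space. Every uncountable Borel set is an injective Baire image up to countably many points. Indeed,
up to a Borel change of topology it is an injective projection of a closed subset of a
zero-dimensional Polish space; the perfect kernel of that closed set omits only countably many
points, and a perfect zero-dimensional Polish space can be split as a point together with infinitely
many small disjoint nonempty clopen sets, repeatedly, so that only the countably many points removed
on the way are missed.

A countable set `C` of exceptional points is absorbed as follows. If disjoint injective Baire images
`R 0`, `R 1`, … shrink to a point `c` outside all of them, then `{c} ∪ ⋃ k, R k` is an injective
Baire image: send the zero sequence to `c`, and the sequences whose first nonzero entry is at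
position `k` to `R k`. When all points of `B` are condensation points, every basic open set meeting
`B` contains infinitely many pieces of a suitable decomposition of `B` up to a countable set `C`,
so each point of `C` can be given its own sequence of pieces shrinking to it.
-/

open Set Filter Function TopologicalSpace

/-- `s` is an injective Baire image: the range of a continuous injection of the Baire space. The
map takes values in the ambient space, so that such sets can be compared and glued. -/
def IsInjBaireImage {X : Type*} [TopologicalSpace X] (s : Set X) : Prop :=
  ∃ f : (ℕ → ℕ) → X, Continuous f ∧ Injective f ∧ range f = s

namespace IsInjBaireImage

variable {X : Type*} [TopologicalSpace X] {s : Set X}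

theorem image {Y : Type*} [TopologicalSpace Y] {f : X → Y} (hs : IsInjBaireImage s)
    (hf : Continuous f) (hinj : Injective f) : IsInjBaireImage (f '' s) := by
  obtain ⟨g, hg, hginj, rfl⟩ := hs
  exact ⟨f ∘ g, hf.comp hg, hinj.comp hginj, range_comp f g⟩

theorem not_countable (hs : IsInjBaireImage s) : ¬ s.Countable := by
  obtain ⟨f, -, hf, rfl⟩ := hs
  have : Uncountable (ℕ → ℕ) :=
    Cardinal.aleph0_lt_mk_iff.1 (by simp [Cardinal.aleph0_lt_continuum])
  refine fun h => not_countable_univ (α := ℕ → ℕ) ?_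
  exact countable_of_injective_of_countable_image hf.injOn (image_univ ▸ h)

theorem measurableSet [MeasurableSpace X] [BorelSpace X] [MeasurableSpace.CountablySeparated X]
    (hs : IsInjBaireImage s) : MeasurableSet s := by
  obtain ⟨f, hf, hinj, rfl⟩ := hs
  exact image_univ ▸ MeasurableSet.univ.image_of_measurable_injOn hf.measurable hinj.injOn

theorem exists_continuous_bijective (hs : IsInjBaireImage s) :
    ∃ f : (ℕ → ℕ) → s, Continuous f ∧ Bijective f := by
  obtain ⟨f, hf, hinj, rfl⟩ := hs
  exact ⟨rangeFactorization f, hf.rangeFactorization, hinj.codRestrict _,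
    rangeFactorization_surjective⟩

end IsInjBaireImage

/-! ### Gluing along a sequence of sets shrinking to a point -/

/-- The sequences whose first nonzero entry is the one at position `k`. These clopen sets partition
the nonzero sequences and shrink to the zero sequence. -/
def leadSet (k : ℕ) : Set (ℕ → ℕ) := PiNat.cylinder 0 k ∩ {x | x k ≠ 0}

/-- The bijection of `leadSet k` onto the Baire space: drop the `k` leading zeros and decrease the
first remaining entry by one. -/
def dropZeros (k : ℕ) (x : ℕ → ℕ) (n : ℕ) : ℕ := if n = 0 then x k - 1 else x (k + n)

theorem eq_zero_or_exists_mem_leadSet (x : ℕ → ℕ) : x = 0 ∨ ∃ k, x ∈ leadSet k := by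
  classical
  refine or_iff_not_imp_left.2 fun hx => ?_
  have h : ∃ k, x k ≠ 0 := Function.ne_iff.1 hx
  exact ⟨Nat.find h, fun j hj => not_not.1 (Nat.find_min h hj), Nat.find_spec h⟩

theorem isOpen_leadSet (k : ℕ) : IsOpen (leadSet k) :=
  (PiNat.isOpen_cylinder (fun _ => ℕ) 0 k).inter
    (isOpen_ne_fun (continuous_apply k) continuous_const)

theorem continuous_dropZeros (k : ℕ) : Continuous (dropZeros k) := by
  refine continuous_pi fun n => ?_
  unfold dropZeros
  split_ifs
  · exact (continuous_of_discreteTopology (f := fun m : ℕ => m - 1)).comp (continuous_apply k)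
  · exact continuous_apply _

theorem injOn_dropZeros (k : ℕ) : InjOn (dropZeros k) (leadSet k) := by
  rintro x hx y hy hxy
  ext n
  rcases lt_trichotomy n k with hn | rfl | hn
  · rw [hx.1 n hn, hy.1 n hn]
  · have hpred : x n - 1 = y n - 1 := congrFun hxy 0
    have hxn : x n ≠ 0 := hx.2
    have hyn : y n ≠ 0 := hy.2
    omega
  · obtain ⟨m, rfl⟩ := Nat.exists_eq_add_of_lt hn
    simpa [dropZeros, add_assoc] using congrFun hxy (m + 1)

theorem surjOn_dropZeros (k : ℕ) : SurjOn (dropZeros k) (leadSet k) univ := by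
  intro z _
  refine ⟨fun n => if n < k then 0 else if n = k then z 0 + 1 else z (n - k), ⟨?_, ?_⟩, ?_⟩
  · intro j hj
    simp [hj]
  · simp
  · ext n
    by_cases hn : n = 0 <;> simp [dropZeros, hn]

/-- The map sending the zero sequence to `c` and `leadSet k` to the range of `g k`, through the
bijection `dropZeros k`. -/
noncomputable def glueAtZero {X : Type*} (c : X) (g : ℕ → (ℕ → ℕ) → X) (x : ℕ → ℕ) : X :=
  open Classical in if h : ∃ k, x k ≠ 0 then g (Nat.find h) (dropZeros (Nat.find h) x) else c

section glueAtZero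

variable {X : Type*} {c : X} {g : ℕ → (ℕ → ℕ) → X}

theorem glueAtZero_zero : glueAtZero c g 0 = c := dif_neg (by simp)

theorem glueAtZero_of_mem_leadSet {k : ℕ} {x : ℕ → ℕ} (hx : x ∈ leadSet k) :
    glueAtZero c g x = g k (dropZeros k x) := by
  classical
  have h : ∃ k, x k ≠ 0 := ⟨k, hx.2⟩
  have hk : Nat.find h = k := (Nat.find_eq_iff h).2 ⟨hx.2, fun j hj => by simpa using hx.1 j hj⟩
  simp only [glueAtZero, dif_pos h, hk]

theorem glueAtZero_mem_range {k : ℕ} {x : ℕ → ℕ} (hx : x ∈ leadSet k) :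
    glueAtZero c g x ∈ range (g k) :=
  glueAtZero_of_mem_leadSet hx ▸ mem_range_self _

theorem range_glueAtZero : range (glueAtZero c g) = insert c (⋃ k, range (g k)) := by
  refine Subset.antisymm (range_subset_iff.2 fun x => ?_) (insert_subset ⟨0, glueAtZero_zero⟩ ?_)
  · obtain rfl | ⟨k, hx⟩ := eq_zero_or_exists_mem_leadSet x
    · exact .inl glueAtZero_zero
    · exact .inr (mem_iUnion.2 ⟨k, glueAtZero_mem_range hx⟩)
  · refine iUnion_subset fun k => range_subset_iff.2 fun z => ?_
    obtain ⟨x, hx, rfl⟩ := surjOn_dropZeros k (mem_univ z)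
    exact ⟨x, glueAtZero_of_mem_leadSet hx⟩

theorem injective_glueAtZero (hg : ∀ k, Injective (g k))
    (hdisj : Pairwise (Disjoint on fun k => range (g k))) (hc : c ∉ ⋃ k, range (g k)) :
    Injective (glueAtZero c g) := by
  have hne {k : ℕ} {x : ℕ → ℕ} (hx : x ∈ leadSet k) : glueAtZero c g x ≠ c := fun h =>
    hc (mem_iUnion.2 ⟨k, h ▸ glueAtZero_mem_range hx⟩)
  intro x y hxy
  obtain rfl | ⟨k, hx⟩ := eq_zero_or_exists_mem_leadSet x <;>
    obtain rfl | ⟨l, hy⟩ := eq_zero_or_exists_mem_leadSet y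
  · rfl
  · exact absurd (hxy.symm.trans glueAtZero_zero) (hne hy)
  · exact absurd (hxy.trans glueAtZero_zero) (hne hx)
  · obtain rfl : k = l := hdisj.eq <| not_disjoint_iff.2
      ⟨_, glueAtZero_mem_range hx, hxy ▸ glueAtZero_mem_range hy⟩
    rw [glueAtZero_of_mem_leadSet hx, glueAtZero_of_mem_leadSet hy] at hxy
    exact injOn_dropZeros k hx hy (hg k hxy)

theorem continuous_glueAtZero [TopologicalSpace X] (hg : ∀ k, Continuous (g k))
    (hlim : Tendsto (fun k => range (g k)) atTop (𝓝 c).smallSets) :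
    Continuous (glueAtZero c g) := by
  refine continuous_iff_continuousAt.2 fun x => ?_
  obtain rfl | ⟨k, hx⟩ := eq_zero_or_exists_mem_leadSet x
  · rw [ContinuousAt, glueAtZero_zero]
    refine fun U hU => mem_map.2 ?_
    obtain ⟨N, hN⟩ := eventually_atTop.1 (tendsto_smallSets_iff.1 hlim U hU)
    filter_upwards [(PiNat.isOpen_cylinder _ 0 N).mem_nhds (PiNat.self_mem_cylinder 0 N)] with y hy
    obtain rfl | ⟨k, hyk⟩ := eq_zero_or_exists_mem_leadSet y
    · exact mem_preimage.2 (glueAtZero_zero ▸ mem_of_mem_nhds hU)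
    · exact hN k (not_lt.1 fun hlt => hyk.2 (hy k hlt)) (glueAtZero_mem_range hyk)
  · refine ((hg k).comp (continuous_dropZeros k)).continuousAt.congr ?_
    filter_upwards [(isOpen_leadSet k).mem_nhds hx] with y hy
      using (glueAtZero_of_mem_leadSet hy).symm

end glueAtZero

namespace IsInjBaireImage

variable {X : Type*} [TopologicalSpace X]

theorem iUnion {ι : Type*} [Countable ι] [Nonempty ι] {K : ι → Set X}
    (hK : ∀ i, IsInjBaireImage (K i)) (hdisj : Pairwise (Disjoint on K)) :
    IsInjBaireImage (⋃ i, K i) := by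
  choose g hgcont hginj hgrange using hK
  obtain rfl : (fun i => range (g i)) = K := funext hgrange
  obtain ⟨_⟩ := nonempty_denumerable (ι × ℕ)
  let σ : ι × ℕ ≃ ℕ := Denumerable.eqv _
  let f (n : ℕ) (x : ℕ → ℕ) : X := g (σ.symm n).1 (update x 0 (σ.symm n).2)
  refine ⟨fun x => f (x 0) x, ?_, fun x y hxy => ?_, ?_⟩
  · have hf (n : ℕ) : Continuous (f n) :=
      (hgcont _).comp (continuous_id.update 0 continuous_const)
    have hf_uncurry : Continuous (uncurry f) := continuous_prod_of_discrete_left.2 hf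
    exact hf_uncurry.comp (.prodMk (continuous_apply 0) continuous_id)
  · have hindex : (σ.symm (x 0)).1 = (σ.symm (y 0)).1 :=
      hdisj.eq (not_disjoint_iff.2 ⟨f (x 0) x, mem_range_self _, _, hxy.symm⟩)
    have hupdate : update x 0 (σ.symm (x 0)).2 = update y 0 (σ.symm (y 0)).2 :=
      hginj _ (by simpa only [f, hindex] using hxy)
    have hhead : x 0 = y 0 :=
      σ.symm.injective (Prod.ext hindex (by simpa using congrFun hupdate 0))
    rw [← update_eq_self 0 x, ← update_eq_self 0 y, hhead]
    simpa only [update_idem] using congrArg (update · 0 (y 0)) hupdate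
  · refine Subset.antisymm (range_subset_iff.2 fun x => mem_iUnion.2 ⟨_, mem_range_self _⟩)
      (iUnion_subset fun i => range_subset_iff.2 fun y => ?_)
    exact ⟨update y 0 (σ (i, y 0)), by simp [f]⟩

theorem insert_limit {R : ℕ → Set X} (hR : ∀ k, IsInjBaireImage (R k))
    (hdisj : Pairwise (Disjoint on R)) {c : X} (hc : c ∉ ⋃ k, R k)
    (hlim : Tendsto R atTop (𝓝 c).smallSets) : IsInjBaireImage (insert c (⋃ k, R k)) := by
  choose g hgcont hginj hgrange using hR
  obtain rfl : (fun k => range (g k)) = R := funext hgrange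
  exact ⟨glueAtZero c g, continuous_glueAtZero hgcont hlim, injective_glueAtZero hginj hdisj hc,
    range_glueAtZero⟩

end IsInjBaireImage

section attachLimits

variable {X ι : Type*} {K : ι → Set X} {C : Set X} {φ : C × ℕ → ι}

/-- The family `K` with the sets `K (φ (c, k))`, `k : ℕ`, merged into one set together with the
point `c`, for each `c ∈ C`; the sets whose index is not in the range of `φ` are unchanged. -/
def attachLimits (K : ι → Set X) (φ : C × ℕ → ι) : C ⊕ ↥(range φ)ᶜ → Set X :=
  Sum.elim (fun c => insert (c : X) (⋃ k, K (φ (c, k)))) (fun i => K i)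

theorem iUnion_attachLimits : ⋃ j, attachLimits K φ j = C ∪ ⋃ i, K i := by
  refine Subset.antisymm (iUnion_subset ?_) (union_subset ?_ (iUnion_subset fun i => ?_))
  · rintro (c | i)
    · exact insert_subset (.inl c.2)
        (iUnion_subset fun k => subset_union_of_subset_right (subset_iUnion K _) _)
    · exact subset_union_of_subset_right (subset_iUnion K _) _
  · exact fun c hc => mem_iUnion.2 ⟨.inl ⟨c, hc⟩, mem_insert _ _⟩
  · by_cases hi : i ∈ range φ
    · obtain ⟨⟨c, k⟩, rfl⟩ := hi
      exact fun x hx => mem_iUnion.2 ⟨.inl c, .inr (mem_iUnion.2 ⟨k, hx⟩)⟩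
    · exact subset_iUnion (attachLimits K φ) (.inr ⟨i, hi⟩)

theorem pairwise_disjoint_attachLimits (hdisj : Pairwise (Disjoint on K))
    (hCK : Disjoint C (⋃ i, K i)) (hφ : Injective φ) :
    Pairwise (Disjoint on attachLimits K φ) := by
  have hcK (c : C) (i : ι) : (c : X) ∉ K i :=
    disjoint_left.1 (disjoint_iUnion_right.1 hCK i) c.2
  have hKeq {x : X} {i j : ι} (hi : x ∈ K i) (hj : x ∈ K j) : i = j :=
    hdisj.eq (not_disjoint_iff.2 ⟨x, hi, hj⟩)
  refine fun j j' hne => disjoint_left.2 fun x hx hx' => hne ?_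
  rcases j with c | ⟨i, hi⟩ <;> rcases j' with c' | ⟨i', hi'⟩ <;>
    simp only [attachLimits, Sum.elim_inl, Sum.elim_inr, mem_insert_iff, mem_iUnion] at hx hx'
  · grind [Injective]
  · grind
  · grind
  · grind

theorem isInjBaireImage_union_limits [TopologicalSpace X] [Countable ι] [Nonempty ι]
    (hK : ∀ i, IsInjBaireImage (K i)) (hdisj : Pairwise (Disjoint on K)) (hC : C.Countable)
    (hCK : Disjoint C (⋃ i, K i)) (hφ : Injective φ)
    (hlim : ∀ c : C, Tendsto (fun k => K (φ (c, k))) atTop (𝓝 (c : X)).smallSets) :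
    IsInjBaireImage (C ∪ ⋃ i, K i) := by
  have := hC.to_subtype
  have hindex : Nonempty (C ⊕ ↥(range φ)ᶜ) := by
    inhabit ι
    by_cases h : default ∈ range φ
    · exact ⟨.inl h.choose.1⟩
    · exact ⟨.inr ⟨default, h⟩⟩
  refine iUnion_attachLimits (K := K) (φ := φ) ▸
    IsInjBaireImage.iUnion ?_ (pairwise_disjoint_attachLimits hdisj hCK hφ)
  rintro (c | i)
  · refine IsInjBaireImage.insert_limit (fun k => hK _) (fun k l hkl => hdisj fun h => hkl ?_) ?_
      (hlim c)
    · exact (Prod.ext_iff.1 (hφ h)).2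
    · exact fun h => disjoint_left.1 hCK c.2 (iUnion_subset (fun k => subset_iUnion K _) h)
  · exact hK i

end attachLimits

/-! ### Borel sets as injective projections of closed sets -/

/-- `A` is the injective projection of a closed subset of `Y × (ℕ → ℕ)`. -/
def IsClosedInjProj {Y : Type*} [TopologicalSpace Y] (A : Set Y) : Prop :=
  ∃ F : Set (Y × (ℕ → ℕ)), IsClosed F ∧ BijOn Prod.fst F A

namespace IsClosedInjProj

variable {Y : Type*} [TopologicalSpace Y]

theorem of_isClosed {A : Set Y} (hA : IsClosed A) : IsClosedInjProj A :=
  ⟨A ×ˢ {0}, hA.prod isClosed_singleton, fun _ hp => hp.1,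
    fun _ hp _ hq h => Prod.ext h (hp.2.trans hq.2.symm), fun y hy => ⟨(y, 0), ⟨hy, rfl⟩, rfl⟩⟩

theorem iInter {A : ℕ → Set Y} (hA : ∀ n, IsClosedInjProj (A n)) :
    IsClosedInjProj (⋂ n, A n) := by
  choose F hclosed hbij using hA
  let part (n : ℕ) (p : Y × (ℕ → ℕ)) : Y × (ℕ → ℕ) := (p.1, fun k => p.2 (Nat.pair n k))
  refine ⟨⋂ n, part n ⁻¹' F n, ?_, ?_, ?_, ?_⟩
  · exact isClosed_iInter fun n => (hclosed n).preimage (by fun_prop)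
  · exact fun p hp => mem_iInter.2 fun n => (hbij n).mapsTo (x := part n p) (mem_iInter.1 hp n)
  · rintro p hp q hq hfst
    have hpart (n : ℕ) : part n p = part n q :=
      (hbij n).injOn (mem_iInter.1 hp n) (mem_iInter.1 hq n) hfst
    refine Prod.ext hfst (funext fun k => ?_)
    simpa only [part, Nat.pair_unpair] using
      congrFun (Prod.ext_iff.1 (hpart k.unpair.1)).2 k.unpair.2
  · intro y hy
    choose p hp hpy using fun n => (hbij n).surjOn (mem_iInter.1 hy n)
    refine ⟨(y, fun k => (p k.unpair.1).2 k.unpair.2), mem_iInter.2 fun n => ?_, rfl⟩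
    have hpart : part n (y, fun k => (p k.unpair.1).2 k.unpair.2) = p n := by
      simp [part, ← hpy n]
    exact mem_preimage.2 (hpart ▸ hp n)

theorem iUnion {A : ℕ → Set Y} (hA : ∀ n, IsClosedInjProj (A n))
    (hdisj : Pairwise (Disjoint on A)) : IsClosedInjProj (⋃ n, A n) := by
  choose F hclosed hbij using hA
  let tail (p : Y × (ℕ → ℕ)) : Y × (ℕ → ℕ) := (p.1, fun k => p.2 (k + 1))
  have hmem {p : Y × (ℕ → ℕ)} (hp : tail p ∈ F (p.2 0)) : p.1 ∈ A (p.2 0) :=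
    (hbij _).mapsTo (x := tail p) hp
  refine ⟨{p | tail p ∈ F (p.2 0)}, ?_, fun p hp => mem_iUnion.2 ⟨_, hmem hp⟩, ?_, ?_⟩
  · have hinter : {p | tail p ∈ F (p.2 0)} = ⋂ n, {p | p.2 0 = n → tail p ∈ F n} := by
      ext; simp
    rw [hinter]
    have hhead : Continuous fun p : Y × (ℕ → ℕ) => p.2 0 := by fun_prop
    exact isClosed_iInter fun n => isClosed_imp ((isOpen_discrete {n}).preimage hhead)
      ((hclosed n).preimage (by fun_prop))
  · rintro p hp q hq hfst
    have hhead : p.2 0 = q.2 0 :=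
      hdisj.eq (not_disjoint_iff.2 ⟨p.1, hmem hp, hfst ▸ hmem hq⟩)
    have htail : tail p = tail q := (hbij _).injOn hp (hhead ▸ hq) hfst
    refine Prod.ext hfst (funext fun k => ?_)
    cases k with
    | zero => exact hhead
    | succ k => exact congrFun (Prod.ext_iff.1 htail).2 k
  · intro y hy
    obtain ⟨n, hn⟩ := mem_iUnion.1 hy
    obtain ⟨⟨y, w⟩, hp, rfl⟩ := (hbij n).surjOn hn
    exact ⟨(y, fun k => k.casesOn n w), by exact hp, rfl⟩

theorem of_measurableSet {A : Set Y}
    (hA : @MeasurableSet Y (MeasurableSpace.generateFrom {s | IsClopen s}) A) :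
    IsClosedInjProj A := by
  suffices h : IsClosedInjProj A ∧ IsClosedInjProj Aᶜ from h.1
  induction A, hA using MeasurableSpace.induction_on_inter rfl with
  | h_inter => exact fun s hs t ht _ => IsClopen.inter hs ht
  | empty => exact ⟨of_isClosed isClosed_empty, of_isClosed (by simp)⟩
  | basic s hs => exact ⟨of_isClosed hs.isClosed, of_isClosed hs.compl.isClosed⟩
  | compl s _ hs => exact ⟨hs.2, (compl_compl s).symm ▸ hs.1⟩
  | iUnion s hdisj _ hs =>
    exact ⟨iUnion (fun n => (hs n).1) hdisj, compl_iUnion s ▸ iInter fun n => (hs n).2⟩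

end IsClosedInjProj

/-! ### Perfect zero-dimensional Polish spaces -/

section ClopenScheme

variable {Y : Type*}

theorem exists_iUnion_eq_of_infinite_nonempty {D : ℕ → Set Y}
    (hD : {n | (D n).Nonempty}.Infinite) :
    ∃ e : ℕ → ℕ, Injective e ∧ (∀ n, (D (e n)).Nonempty) ∧ ⋃ n, D (e n) = ⋃ n, D n := by
  have := hD.to_subtype
  let e := Nat.Subtype.orderIsoOfNat {n | (D n).Nonempty}
  refine ⟨fun n => e n, Subtype.val_injective.comp e.injective, fun n => (e n).2, ?_⟩
  refine Subset.antisymm (iUnion_subset fun n => subset_iUnion D _) (iUnion_subset fun n y hy => ?_)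
  obtain ⟨k, hk⟩ := e.surjective ⟨n, y, hy⟩
  exact mem_iUnion.2 ⟨k, by simpa only [hk] using hy⟩

theorem exists_small_clopen_cover [PseudoMetricSpace Y] [SecondCountableTopology Y]
    (hbasis : IsTopologicalBasis {s : Set Y | IsClopen s}) {U : Set Y} (hU : IsOpen U)
    {ε : ENNReal} (hε : 0 < ε) :
    ∃ t : ℕ → Set Y, (∀ n, IsClopen (t n) ∧ Metric.ediam (t n) ≤ ε) ∧ ⋃ n, t n = U := by
  let S : Set (Set Y) := {s | (IsClopen s ∧ Metric.ediam s ≤ ε) ∧ s ⊆ U}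
  have hS : ⋃₀ S = U := by
    refine Subset.antisymm (sUnion_subset fun s hs => hs.2) fun y hy => ?_
    have hball : U ∩ Metric.eball y (ε / 2) ∈ 𝓝 y :=
      inter_mem (hU.mem_nhds hy) (Metric.eball_mem_nhds y (ENNReal.half_pos hε.ne'))
    obtain ⟨s, hs, hys, hsub⟩ := hbasis.mem_nhds_iff.1 hball
    refine mem_sUnion.2 ⟨s, ⟨⟨hs, ?_⟩, hsub.trans inter_subset_left⟩, hys⟩
    calc Metric.ediam s ≤ Metric.ediam (Metric.eball y (ε / 2)) :=
          Metric.ediam_mono (hsub.trans inter_subset_right)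
      _ ≤ 2 * (ε / 2) := Metric.ediam_eball_le
      _ = ε := ENNReal.mul_div_cancel two_ne_zero ENNReal.ofNat_ne_top
  obtain ⟨T, hT, hTS, hTU⟩ := isOpen_sUnion_countable S fun s hs => hs.1.1.isOpen
  obtain ⟨t, ht⟩ := (hT.insert ∅).exists_eq_range (insert_nonempty ∅ T)
  refine ⟨t, fun n => ?_, ?_⟩
  · obtain hn | hn : t n = ∅ ∨ t n ∈ T := mem_insert_iff.1 (ht ▸ mem_range_self n)
    · simp [hn, isClopen_empty]
    · exact (hTS hn).1
  · rw [← sUnion_range, ← ht, sUnion_insert, empty_union, hTU, hS]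

theorem exists_small_clopen_partition [PseudoMetricSpace Y] [SecondCountableTopology Y]
    (hbasis : IsTopologicalBasis {s : Set Y | IsClopen s}) {U : Set Y} (hU : IsOpen U)
    (hU' : ¬ IsClosed U) {ε : ENNReal} (hε : 0 < ε) :
    ∃ C : ℕ → Set Y, (∀ n, IsClopen (C n) ∧ (C n).Nonempty ∧ Metric.ediam (C n) ≤ ε) ∧
      Pairwise (Disjoint on C) ∧ ⋃ n, C n = U := by
  obtain ⟨t, ht, rfl⟩ := exists_small_clopen_cover hbasis hU hε
  have hclopen (n : ℕ) : IsClopen (disjointed t n) :=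
    disjointedRec (p := IsClopen) (fun _ i hs => hs.diff (ht i).1) (ht n).1
  have hinfinite : {n | (disjointed t n).Nonempty}.Infinite := by
    refine fun hfin => hU' ?_
    have hunion : ⋃ n, t n = ⋃ n ∈ {n | (disjointed t n).Nonempty}, disjointed t n := by
      ext y
      simp only [← iUnion_disjointed (f := t), mem_iUnion, mem_ofPred_eq, exists_prop]
      exact exists_congr fun n => ⟨fun h => ⟨⟨y, h⟩, h⟩, And.right⟩
    exact hunion ▸ hfin.isClosed_biUnion fun n _ => (hclopen n).isClosed
  obtain ⟨e, he, hnonempty, hunion⟩ := exists_iUnion_eq_of_infinite_nonempty hinfinite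
  exact ⟨fun n => disjointed t (e n), fun n => ⟨hclopen _, hnonempty n,
    (Metric.ediam_mono (disjointed_subset t _)).trans (ht _).2⟩,
    (disjoint_disjointed t).comp_of_injective he, hunion.trans iUnion_disjointed⟩

theorem exists_small_clopen_partition_sdiff_singleton [MetricSpace Y] [SecondCountableTopology Y]
    [PerfectSpace Y] (hbasis : IsTopologicalBasis {s : Set Y | IsClopen s}) {S : Set Y}
    (hS : IsClopen S) (hne : S.Nonempty) {ε : ENNReal} (hε : 0 < ε) :
    ∃ (p : Y) (C : ℕ → {S : Set Y // IsClopen S ∧ S.Nonempty}),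
      (∀ a, Metric.ediam (C a : Set Y) ≤ ε) ∧ Pairwise (Disjoint on fun a => (C a : Set Y)) ∧
        ⋃ a, (C a : Set Y) = S \ {p} := by
  obtain ⟨p, hp⟩ := hne
  have hnot_closed : ¬ IsClosed (S \ {p}) := fun h => not_isOpen_singleton p <| by
    simpa [inter_eq_right.2 (singleton_subset_iff.2 hp)] using hS.isOpen.sdiff h
  obtain ⟨C, hC, hdisj, hunion⟩ := exists_small_clopen_partition hbasis
    (hS.isOpen.sdiff isClosed_singleton) hnot_closed hε
  exact ⟨p, fun a => ⟨C a, (hC a).1, (hC a).2.1⟩, fun a => (hC a).2.2, hdisj, hunion⟩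

theorem mem_range_inducedMap [MetricSpace Y] {A : List ℕ → Set Y}
    (hdiam : CantorScheme.VanishingDiam A) {y : Y} (hy : y ∈ A [])
    (hstep : ∀ l, y ∈ A l → ∃ a, y ∈ A (a :: l)) : y ∈ range (CantorScheme.inducedMap A).2 := by
  choose! a ha using hstep
  let branch (n : ℕ) : List ℕ := n.rec [] fun _ l => a l :: l
  have hbranch (n : ℕ) : y ∈ A (branch n) := n.rec hy fun n ih => ha _ ih
  have hres (n : ℕ) : PiNat.res (fun n => a (branch n)) n = branch n :=
    n.rec rfl fun n ih => by rw [PiNat.res_succ, ih]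
  have hmem (n : ℕ) : y ∈ A (PiNat.res (fun n => a (branch n)) n) := hres n ▸ hbranch n
  let x : (CantorScheme.inducedMap A).1 := ⟨_, y, mem_iInter.2 hmem⟩
  refine ⟨x, edist_le_zero.1 (ge_of_tendsto' (hdiam x) fun n => ?_)⟩
  exact Metric.edist_le_ediam_of_mem (CantorScheme.map_mem x n) (hmem n)

theorem exists_clopen_scheme [MetricSpace Y] [SecondCountableTopology Y] [PerfectSpace Y]
    [Nonempty Y] (hbasis : IsTopologicalBasis {s : Set Y | IsClopen s}) :
    ∃ (A : List ℕ → Set Y) (p : List ℕ → Y),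
      A [] = univ ∧ (∀ l, IsClopen (A l) ∧ (A l).Nonempty) ∧
      CantorScheme.VanishingDiam A ∧ CantorScheme.Disjoint A ∧
      ∀ l, ⋃ a, A (a :: l) = A l \ {p l} := by
  choose p C hdiam hdisj hunion using fun S : {S : Set Y // IsClopen S ∧ S.Nonempty} =>
    fun n : ℕ => exists_small_clopen_partition_sdiff_singleton hbasis S.2.1 S.2.2
      (ENNReal.inv_pos.2 (ENNReal.natCast_ne_top (n + 1)))
  let A : List ℕ → {S : Set Y // IsClopen S ∧ S.Nonempty} :=
    List.rec ⟨univ, isClopen_univ, univ_nonempty⟩ fun a l S => C S l.length a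
  refine ⟨fun l => (A l).1, fun l => p (A l) l.length, rfl, fun l => (A l).2, fun x => ?_,
    fun l => hdisj _ _, fun l => hunion (A l) l.length⟩
  refine (tendsto_add_atTop_iff_nat 1).1 ?_
  have hle (n : ℕ) : Metric.ediam (A (PiNat.res x (n + 1))).1 ≤ ((n + 1 : ℕ) : ENNReal)⁻¹ := by
    calc Metric.ediam (A (PiNat.res x (n + 1))).1
      _ ≤ (((PiNat.res x n).length + 1 : ℕ) : ENNReal)⁻¹ :=
          hdiam (A (PiNat.res x n)) (PiNat.res x n).length (x n)
      _ = ((n + 1 : ℕ) : ENNReal)⁻¹ := by rw [PiNat.res_length]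
  exact tendsto_of_tendsto_of_tendsto_of_le_of_le tendsto_const_nhds
    (ENNReal.tendsto_inv_nat_nhds_zero.comp (tendsto_add_atTop_nat 1)) (fun _ => zero_le) hle

theorem exists_continuous_injective_countable_compl_range (Y : Type*) [TopologicalSpace Y]
    [PolishSpace Y] [PerfectSpace Y] [Nonempty Y]
    (hbasis : IsTopologicalBasis {s : Set Y | IsClopen s}) :
    ∃ f : (ℕ → ℕ) → Y, Continuous f ∧ Injective f ∧ (range f)ᶜ.Countable := by
  let := upgradeIsCompletelyMetrizable Y
  obtain ⟨A, p, hroot, hA, hdiam, hdisj, hunion⟩ := exists_clopen_scheme hbasis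
  have hchild (l : List ℕ) (a : ℕ) : A (a :: l) ⊆ A l :=
    (subset_iUnion (fun a => A (a :: l)) a).trans ((hunion l).subset.trans sdiff_subset)
  have hanti : CantorScheme.ClosureAntitone A :=
    CantorScheme.Antitone.closureAntitone hchild fun l => (hA l).1.isClosed
  have htotal := hanti.map_of_vanishingDiam hdiam fun l => (hA l).2
  have hmem (x : ℕ → ℕ) : x ∈ (CantorScheme.inducedMap A).1 := htotal ▸ mem_univ x
  refine ⟨fun x => (CantorScheme.inducedMap A).2 ⟨x, hmem x⟩,
    hdiam.map_continuous.comp (continuous_id.subtype_mk hmem),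
    hdisj.map_injective.comp fun x y h => congrArg Subtype.val h,
    (countable_range p).mono (compl_subset_comm.1 fun y hy => ?_)⟩
  obtain ⟨x, rfl⟩ := mem_range_inducedMap hdiam (hroot ▸ mem_univ y) fun l hl =>
    mem_iUnion.1 ((hunion l).symm ▸ ⟨hl, fun h => hy ⟨l, h.symm⟩⟩)
  exact ⟨x, rfl⟩

end ClopenScheme

theorem isTopologicalBasis_isClopen_subtype {Y : Type*} [TopologicalSpace Y]
    (hbasis : IsTopologicalBasis {s : Set Y | IsClopen s}) (P : Set Y) :
    IsTopologicalBasis {s : Set P | IsClopen s} :=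
  (hbasis.induced ((↑) : P → Y)).of_isOpen_of_subset (fun _ => IsClopen.isOpen) <|
    image_subset_iff.2 fun _ hs => hs.preimage continuous_subtype_val

theorem perfectSpace_coe_of_preperfect {Y : Type*} [TopologicalSpace Y] {P : Set Y}
    (hP : Preperfect P) : PerfectSpace P := by
  refine ⟨preperfect_iff_nhds.2 fun x _ U hU => ?_⟩
  obtain ⟨V, hV, hVU⟩ := (mem_nhds_subtype P x U).1 hU
  obtain ⟨y, hy, hne⟩ := preperfect_iff_nhds.1 hP x x.2 V hV
  exact ⟨⟨y, hy.2⟩, ⟨hVU hy.1, mem_univ _⟩, fun h => hne (congrArg Subtype.val h)⟩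

theorem exists_isInjBaireImage_of_isClosed {Y : Type*} [TopologicalSpace Y] [PolishSpace Y]
    (hbasis : IsTopologicalBasis {s : Set Y | IsClopen s}) {F : Set Y} (hF : IsClosed F)
    (hunc : ¬ F.Countable) : ∃ K ⊆ F, IsInjBaireImage K ∧ (F \ K).Countable := by
  obtain ⟨V, P, hV, hP, rfl⟩ := exists_countable_union_perfect_of_isClosed hF
  have : Nonempty P := by
    rw [nonempty_coe_sort, nonempty_iff_ne_empty]
    rintro rfl
    exact hunc (by simpa only [union_empty] using hV)
  have : PerfectSpace P := perfectSpace_coe_of_preperfect hP.acc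
  have : PolishSpace P := hP.closed.polishSpace
  obtain ⟨f, hf, hfinj, hfrange⟩ := exists_continuous_injective_countable_compl_range P
    (isTopologicalBasis_isClopen_subtype hbasis P)
  refine ⟨range (Subtype.val ∘ f), range_subset_iff.2 fun x => .inr (f x).2,
    ⟨_, continuous_subtype_val.comp hf, Subtype.val_injective.comp hfinj, rfl⟩,
    (hV.union (hfrange.image Subtype.val)).mono ?_⟩
  rintro y ⟨hy | hy, hyK⟩
  · exact .inl hy
  · exact .inr ⟨⟨y, hy⟩, fun ⟨x, hx⟩ => hyK ⟨x, congrArg Subtype.val hx⟩, rfl⟩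

/-! ### Uncountable Borel sets -/

section basisCode

variable {X : Type*} [TopologicalSpace X] [SecondCountableTopology X]

/-- The point `x` coded by the indicators of the basic open sets containing it: a Borel map into a
zero-dimensional Polish space whose inverse is continuous on its range. -/
noncomputable def basisCode (x : X) (U : countableBasis X) : ℕ := (U : Set X).indicator 1 x

theorem measurable_basisCode [MeasurableSpace X] [OpensMeasurableSpace X] :
    Measurable (basisCode (X := X)) :=
  measurable_pi_lambda _ fun U =>
    measurable_one.indicator (isOpen_of_mem_countableBasis U.2).measurableSet

theorem comap_basisCode_nhds_le (x : X) : comap basisCode (𝓝 (basisCode x)) ≤ 𝓝 x := by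
  intro V hV
  obtain ⟨U, hU, hxU, hUV⟩ := (isBasis_countableBasis X).mem_nhds_iff.1 hV
  have hmem (y : X) : basisCode y ⟨U, hU⟩ = 1 ↔ y ∈ U := by
    classical simp [basisCode, indicator_apply]
  refine ⟨{z | z ⟨U, hU⟩ = 1}, ?_, fun y hy => hUV ((hmem y).1 hy)⟩
  exact ((isOpen_discrete {1}).preimage (continuous_apply _)).mem_nhds ((hmem x).2 hxU)

theorem injective_basisCode [T0Space X] : Injective (basisCode (X := X)) := by
  have hspec {x y : X} (h : basisCode x = basisCode y) : x ⤳ y := by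
    refine specializes_iff_pure.2 (le_trans ?_ (comap_basisCode_nhds_le y))
    exact map_le_iff_le_comap.1 ((map_pure _ _).trans_le (h ▸ pure_le_nhds _))
  exact fun x y h => ((hspec h).antisymm (hspec h.symm)).eq

end basisCode

theorem exists_isInjBaireImage_of_measurableSet {X : Type*} [TopologicalSpace X]
    [SecondCountableTopology X] [MeasurableSpace X] [BorelSpace X] [StandardBorelSpace X]
    {R : Set X} (hR : MeasurableSet R) (hunc : ¬ R.Countable) :
    ∃ K ⊆ R, IsInjBaireImage K ∧ (R \ K).Countable := by
  have : T0Space X :=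
    ⟨fun x y h => MeasurableSpace.separatesPoints_def fun s hs => (h.mem_measurableSet_iff hs).1⟩
  have hinj : Injective (basisCode (X := X)) := injective_basisCode
  have hcode : MeasurableSet (basisCode '' R) :=
    hR.image_of_measurable_injOn measurable_basisCode hinj.injOn
  obtain ⟨F, hF, hbij⟩ : IsClosedInjProj (basisCode '' R) :=
    IsClosedInjProj.of_measurableSet <| by
      rwa [← isTopologicalBasis_clopens.borel_eq_generateFrom, ← BorelSpace.measurable_eq]
  obtain ⟨_, hgF, ⟨g, hg, hginj, rfl⟩, hcount⟩ :=
    exists_isInjBaireImage_of_isClosed isTopologicalBasis_clopens hF fun h =>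
      hunc (countable_of_injective_of_countable_image hinj.injOn (hbij.image_eq ▸ h.image _))
  replace hgF (z : ℕ → ℕ) : g z ∈ F := hgF (mem_range_self z)
  choose f hfR hf using fun z => hbij.mapsTo (hgF z)
  refine ⟨range f, range_subset_iff.2 hfR, ⟨f, ?_, fun z w hzw => ?_, rfl⟩, ?_⟩
  · refine continuous_iff_continuousAt.2 fun z => ?_
    refine (tendsto_comap_iff.2 ?_).mono_right (comap_basisCode_nhds_le (f z))
    simpa only [comp_def, hf] using (continuous_fst.comp hg).tendsto z
  · exact hginj (hbij.injOn (hgF z) (hgF w) (by rw [← hf, ← hf, hzw]))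
  · refine countable_of_injective_of_countable_image hinj.injOn ((hcount.image Prod.fst).mono ?_)
    rintro _ ⟨x, ⟨hxR, hxf⟩, rfl⟩
    obtain ⟨p, hpF, hpx⟩ := hbij.surjOn (mem_image_of_mem _ hxR)
    exact ⟨p, ⟨hpF, fun ⟨z, hz⟩ => hxf ⟨z, hinj (by rw [hf, hz, hpx])⟩⟩, hpx⟩

/-! ### Decomposition into disjoint pieces -/

/-- The sequence starting like `w` up to position `N`, and continuing with the entries of `z`, each
of them tagged by `m`, which makes the ranges for different `m` disjoint. -/
def appendTagged (w : ℕ → ℕ) (N m : ℕ) (z : ℕ → ℕ) (k : ℕ) : ℕ :=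
  if k < N then w k else Nat.pair m (z (k - N))

theorem appendTagged_mem_cylinder (w : ℕ → ℕ) (N m : ℕ) (z : ℕ → ℕ) :
    appendTagged w N m z ∈ PiNat.cylinder w N := fun _ hk => if_pos hk

theorem appendTagged_add (w : ℕ → ℕ) (N m : ℕ) (z : ℕ → ℕ) (k : ℕ) :
    appendTagged w N m z (N + k) = Nat.pair m (z k) := by
  simp [appendTagged]

theorem isInjBaireImage_range_appendTagged (w : ℕ → ℕ) (N m : ℕ) :
    IsInjBaireImage (range (appendTagged w N m)) := by
  refine ⟨appendTagged w N m, continuous_pi fun k => ?_, fun z z' h => funext fun k => ?_, rfl⟩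
  · unfold appendTagged
    split_ifs
    · exact continuous_const
    · exact (continuous_of_discreteTopology (f := Nat.pair m)).comp (continuous_apply _)
  · have hk := congrFun h (N + k)
    rw [appendTagged_add, appendTagged_add, Nat.pair_eq_pair] at hk
    exact hk.2

theorem disjoint_range_appendTagged (w w' : ℕ → ℕ) (N N' : ℕ) {m m' : ℕ} (h : m ≠ m') :
    Disjoint (range (appendTagged w N m)) (range (appendTagged w' N' m')) := by
  refine disjoint_left.2 ?_
  rintro _ ⟨z, rfl⟩ ⟨z', hz⟩
  have hentry := congrFun hz (N + N')
  rw [appendTagged_add, add_comm, appendTagged_add, Nat.pair_eq_pair] at hentry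
  exact h hentry.1.symm

theorem exists_pairwise_disjoint_isInjBaireImage_subset_of_isOpen {ι : Type*} [Countable ι]
    {W : ι → Set (ℕ → ℕ)} (hW : ∀ i, IsOpen (W i)) (hne : ∀ i, (W i).Nonempty) :
    ∃ K : ι → Set (ℕ → ℕ), (∀ i, IsInjBaireImage (K i)) ∧ Pairwise (Disjoint on K) ∧
      ∀ i, K i ⊆ W i := by
  obtain ⟨m, hm⟩ := exists_injective_nat ι
  choose w hw using hne
  have hcylinder (i : ι) : ∃ N, PiNat.cylinder (w i) N ⊆ W i := by
    obtain ⟨_, ⟨x, N, rfl⟩, hx, hsub⟩ :=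
      (PiNat.isTopologicalBasis_cylinders fun _ => ℕ).mem_nhds_iff.1 ((hW i).mem_nhds (hw i))
    exact ⟨N, PiNat.mem_cylinder_iff_eq.1 hx ▸ hsub⟩
  choose N hN using hcylinder
  exact ⟨fun i => range (appendTagged (w i) (N i) (m i)),
    fun i => isInjBaireImage_range_appendTagged _ _ _,
    fun i j hij => disjoint_range_appendTagged _ _ _ _ (hm.ne hij),
    fun i => range_subset_iff.2 fun z => hN i (appendTagged_mem_cylinder _ _ _ z)⟩

section Decomposition

variable {X : Type*} [TopologicalSpace X] [SecondCountableTopology X] [MeasurableSpace X]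
  [BorelSpace X] [StandardBorelSpace X] {ι : Type*} [Countable ι] {B : Set X} {U : ι → Set X}

theorem exists_pairwise_disjoint_isInjBaireImage_subset_inter (hB : MeasurableSet B)
    (hU : ∀ i, IsOpen (U i)) (hUB : ∀ i, ¬ (U i ∩ B).Countable) :
    ∃ K : ι → Set X, (∀ i, IsInjBaireImage (K i)) ∧ Pairwise (Disjoint on K) ∧
      ∀ i, K i ⊆ U i ∩ B := by
  obtain hι | ⟨⟨i₀⟩⟩ := isEmpty_or_nonempty ι
  · exact ⟨fun _ => ∅, hι.elim, fun i => hι.elim i, hι.elim⟩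
  obtain ⟨_, hsub, ⟨f, hf, hinj, rfl⟩, hcount⟩ :=
    exists_isInjBaireImage_of_measurableSet hB fun h => hUB i₀ (h.mono inter_subset_right)
  have hmeet (i : ι) : (f ⁻¹' U i).Nonempty := by
    by_contra hempty
    have hsdiff : U i ∩ B ⊆ B \ range f := by
      rintro x ⟨hxU, hxB⟩
      exact ⟨hxB, fun ⟨z, hz⟩ => hempty ⟨z, mem_preimage.2 (hz.symm ▸ hxU)⟩⟩
    exact hUB i (hcount.mono hsdiff)
  obtain ⟨K, hK, hdisj, hKU⟩ := exists_pairwise_disjoint_isInjBaireImage_subset_of_isOpen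
    (fun i => (hU i).preimage hf) hmeet
  exact ⟨fun i => f '' K i, fun i => (hK i).image hf hinj,
    fun i j hij => (disjoint_image_iff hinj).2 (hdisj hij), fun i => subset_inter
      (image_subset_iff.2 (hKU i)) ((image_subset_range f _).trans hsub)⟩

theorem exists_pairwise_disjoint_isInjBaireImage_countable_sdiff (hB : MeasurableSet B)
    (hunc : ¬ B.Countable) (hU : ∀ i, IsOpen (U i)) (hUB : ∀ i, ¬ (U i ∩ B).Countable) :
    ∃ K : Option ι → Set X, (∀ i, IsInjBaireImage (K i)) ∧ Pairwise (Disjoint on K) ∧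
      (∀ i, K i ⊆ B) ∧ (∀ i, K (some i) ⊆ U i) ∧ (B \ ⋃ i, K i).Countable := by
  obtain ⟨K, hK, hdisj, hKU⟩ := exists_pairwise_disjoint_isInjBaireImage_subset_inter
    (U := fun i : Option ι => i.elim univ U) hB (Option.forall.2 ⟨isOpen_univ, hU⟩)
    (Option.forall.2 ⟨by simpa using hunc, hUB⟩)
  -- The piece `K none` only ensures that the remainder `R` is uncountable.
  let R : Set X := B \ ⋃ i, K (some i)
  have hR : MeasurableSet R := hB.diff (.iUnion fun i => (hK _).measurableSet)
  have hsubR : K none ⊆ R := subset_sdiff.2 ⟨(hKU none).trans inter_subset_right,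
    disjoint_iUnion_right.2 fun i => hdisj (Option.some_ne_none i).symm⟩
  obtain ⟨L, hLR, hL, hcount⟩ := exists_isInjBaireImage_of_measurableSet hR
    fun h => (hK none).not_countable (h.mono hsubR)
  have hLK (i : ι) : Disjoint L (K (some i)) :=
    disjoint_iUnion_right.1 (subset_sdiff.1 hLR).2 i
  refine ⟨fun i => i.elim L fun i => K (some i), Option.forall.2 ⟨hL, fun i => hK (some i)⟩, ?_,
    Option.forall.2 ⟨hLR.trans sdiff_subset, fun i => (hKU _).trans inter_subset_right⟩,
    fun i => (hKU _).trans inter_subset_left, ?_⟩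
  · rintro (_ | i) (_ | j) hij
    · exact absurd rfl hij
    · exact hLK j
    · exact (hLK i).symm
    · exact hdisj hij
  · simpa only [iUnion_option, Option.elim_none, Option.elim_some, R, Set.sdiff_sdiff, union_comm]
      using hcount

theorem isInjBaireImage_of_forall_isCondensationPoint (hB : MeasurableSet B)
    (hne : B.Nonempty) (hcond : ∀ x ∈ B, IsCondensationPoint x B) : IsInjBaireImage B := by
  have hopen {U : Set X} (hU : IsOpen U) : (U ∩ B).Nonempty → ¬ (U ∩ B).Countable :=
    fun ⟨x, hxU, hxB⟩ => hcond x hxB U (hU.mem_nhds hxU)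
  let ι : Type _ := {U : countableBasis X // (U.1 ∩ B).Nonempty} × ℕ
  have hιopen (i : ι) : IsOpen i.1.1.1 := isOpen_of_mem_countableBasis i.1.1.2
  obtain ⟨K, hK, hdisj, hKB, hKU, hcount⟩ :=
    exists_pairwise_disjoint_isInjBaireImage_countable_sdiff hB
      (by simpa using hopen isOpen_univ (by simpa using hne)) hιopen
      fun i => hopen (hιopen i) i.1.2
  let C : Set X := B \ ⋃ i, K i
  have := hcount.to_subtype
  obtain ⟨code, hcode⟩ := exists_injective_nat (C × ℕ)
  have hnhds (c : C) :=
    ((isBasis_countableBasis X).nhds_hasBasis (a := c.1)).exists_antitone_subbasis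
  choose V hV hVlim using hnhds
  let φ (p : C × ℕ) : ι :=
    ⟨⟨⟨V p.1 p.2, (hV p.1 p.2).1⟩, ⟨p.1, (hV p.1 p.2).2, p.1.2.1⟩⟩, code p⟩
  have hφ : Injective φ := fun p q h => hcode (congrArg Prod.snd h)
  have hunion : C ∪ ⋃ i, K i = B := sdiff_union_of_subset (iUnion_subset hKB)
  refine hunion ▸ isInjBaireImage_union_limits hK hdisj hcount disjoint_sdiff_left
    ((Option.some_injective ι).comp hφ) fun c => ?_
  exact (hVlim c).tendsto_smallSets.smallSets_mono (.of_forall fun k => hKU (φ (c, k)))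

end Decomposition

theorem mainTheorem4_general {X : Type*} [TopologicalSpace X] [SecondCountableTopology X]
    [MeasurableSpace X] [BorelSpace X] [StandardBorelSpace X] (B : Set X) (hB : MeasurableSet B)
    (hne : B.Nonempty) (hcond : ∀ x ∈ B, IsCondensationPoint x B) :
    ∃ f : (ℕ → ℕ) → B, Continuous f ∧ Function.Bijective f :=
  (isInjBaireImage_of_forall_isCondensationPoint hB hne hcond).exists_continuous_bijective

theorem mainTheorem4 {X : Type*} [TopologicalSpace X] [PolishSpace X]
    [MeasurableSpace X] [BorelSpace X] (B : Set X) (hB : MeasurableSet B)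
    (hne : B.Nonempty) (hcond : ∀ x ∈ B, IsCondensationPoint x B) :
    ∃ f : (ℕ → ℕ) → B, Continuous f ∧ Function.Bijective f :=
  mainTheorem4_general B hB hne hcond
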